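/- Let $P$ be a nonempty set of primes. For $p\in P$ and $a\in\mathbb{Z}$ let $v_p(a)=\sup\{k\in\mathbb{N} : p^k\mid a\}\in\mathbb{N}\cup\{\infty\}$ be the $p$-adic valuation (so $v_p(0)=\infty$). Let $L_P^E=\{+,-,0,1\}\cup\{D_n : n\geq 1\}\cup\{|_p : p\in P\}$ be the first-order language in which $+$ is a binary and $-$ a unary function symbol, $0$ and $1$ are constants, each $D_n$ is a unary and each $|_p$ a binary relation symbol. Regard $\mathbb{Z}$ as an $L_P^E$-structure by interpreting $+,-,0,1$ as usual, $D_n$ as $\{na : a\in\mathbb{Z}\}$, and $a\,|_p\,b$ as $v_p(a)\leq v_p(b)$. Let $T_P$ denote the complete $L_P^E$-theory of this structure, i.e. the set of all $L_P^E$-sentences true in it. Then $T_P$ eliminates quantifiers: for every $n\geq 0$ and every $L_P^E$-formula $\varphi(x_1,\dots,x_n)$ there is a quantifier-free $L_P^E$-formula $\psi(x_1,\dots,x_n)$ such that $T_P\models\forall x_1\cdots\forall x_n\,(\varphi\leftrightarrow\psi)$. -/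

import Mathlib

open FirstOrder

/-- A first-order theory `T` eliminates quantifiers: every formula in finitely many free variables
is equivalent modulo `T` to a quantifier-free formula in the same free variables. -/
def EliminatesQuantifiers {L : Language} (T : L.Theory) : Prop :=
  ∀ (n : ℕ) (φ : L.Formula (Fin n)),
    ∃ ψ : L.Formula (Fin n), Language.BoundedFormula.IsQF ψ ∧ φ ⇔[T] ψ

/-- The function symbols `+`, `-` (unary), `0`, `1`. -/
inductive ValFunc : ℕ → Type
  | add : ValFunc 2
  | neg : ValFunc 1
  | zero : ValFunc 0
  | one : ValFunc 0

/-- The relation symbols: a binary symbol `|_p` for each `p ∈ P`, and a unary symbol `D_n` for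
each integer `n ≥ 1`. -/
inductive ValRel (P : Set ℕ) : ℕ → Type
  | dvd (p : P) : ValRel P 2
  | D (n : ℕ+) : ValRel P 1

/-- The language `L_P^E = {+, -, 0, 1} ∪ {D_n : n ≥ 1} ∪ {|_p : p ∈ P}`. -/
abbrev valLang (P : Set ℕ) : Language where
  Functions := ValFunc
  Relations := ValRel P

/-- The integers as a structure for `L_P^E`: `D_n` is the set of multiples of `n`, and `a |_p b`
means `v_p(a) ≤ v_p(b)`, where `v_p(a) = sup {k : p ^ k ∣ a} ∈ ℕ ∪ {∞}` is the `p`-adic valuation,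
so `v_p(0) = ∞`. -/
instance valStructure (P : Set ℕ) : (valLang P).Structure ℤ where
  funMap := fun {_} f =>
    match f with
    | ValFunc.add => fun x => x 0 + x 1
    | ValFunc.neg => fun x => - x 0
    | ValFunc.zero => fun _ => 0
    | ValFunc.one => fun _ => 1
  RelMap := fun {_} r =>
    match r with
    | ValRel.dvd p => fun x =>
        emultiplicity (((p : ℕ) : ℤ)) (x 0) ≤ emultiplicity (((p : ℕ) : ℤ)) (x 1)
    | ValRel.D n => fun x => ∃ a : ℤ, x 0 = ((n : ℕ) : ℤ) * a

/-- The theory `T_P` in the language `L_P^E`: the set of all `L_P^E`-sentences that are true in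
the integers. -/
def valTheory (P : Set ℕ) : (valLang P).Theory :=
  (valLang P).completeTheory ℤ

/-!
All the work takes place in `ℤ`: two formulas are equivalent modulo the complete theory of `ℤ` as
soon as they define the same relation on `ℤ` (`ValLang.completeTheory_iff_of_realize_iff`). The
proof is a finitary back-and-forth argument. Call two tuples of integers indistinguishable at a
finite level `(F, N, 𝒯)` if the finitely many terms in `𝒯` compare in the same way under `v_p` for each `p` in
the finite set `F ⊆ P`, and are congruent modulo `N` (`ValLang.Indist`). Every formula is invariant
under indistinguishability at some finite level (`ValLang.isIndistInvariant`), and a relation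
invariant in this sense is a Boolean combination of finitely many atomic formulas
(`ValLang.exists_isQF_of_saturated`).

Invariance is proved by induction on the formula, and the quantifier step is the extension property
`ValLang.exists_indist_snoc`: if two tuples `y`, `y'` are indistinguishable at a fine level, each
integer `x` has a counterpart `x'` for which the extended tuples are indistinguishable at the given
level. After scaling, the terms involving `x` become differences `z - u i`, with `z = A x` and
centres `u i` depending on `y` only. If `z` is one of the centres, its counterpart is the
corresponding centre. If not, all the valuations involved are finite and hence locally constant, so
that the Chinese remainder theorem reduces the problem to a single prime `p`
(`exists_pointData_sameCuts_of_finset`).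

At a single prime, let `u i₀` be a centre nearest to `z` and `α` the valuation of `z - u i₀`. Then
`v_p (z - u i) = min α (v_p (u i - u i₀))`, so only the position of `α` relative to the data has to
be transferred. A suitable `α'` is found in the ordered set `ℕ∞` (`SameCuts.exists_extend`), and a
point `z'` branching off at valuation `α'` is found because the residue field is finite: the number
of residue classes occupied by the centres is the same on both sides
(`exists_emultiplicity_sub_eq_min`).
-/

/-! ### Families of extended naturals with the same cuts -/

/-- `SameCuts C f f'` says that the families `f` and `f'` of extended naturals satisfy the same
comparisons `f a + c ≤ f b + d` with offsets `c, d ≤ C`. Offsets stand on both sides because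
subtraction is not available in `ℕ∞`. For `C ≥ 1` the relation also determines which values are
infinite, by comparing `f a + 1` with `f a`. -/
def SameCuts {ι : Type*} (C : ℕ) (f f' : ι → ℕ∞) : Prop :=
  ∀ a b, ∀ c ≤ C, ∀ d ≤ C, f a + (c : ℕ∞) ≤ f b + (d : ℕ∞) ↔ f' a + (c : ℕ∞) ≤ f' b + (d : ℕ∞)

namespace SameCuts

variable {ι : Type*} {C : ℕ} {f f' : ι → ℕ∞}

theorem mono {B : ℕ} (h : SameCuts C f f') (hBC : B ≤ C) : SameCuts B f f' :=
  fun a b c hc d hd => h a b c (hc.trans hBC) d (hd.trans hBC)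

theorem comp {κ : Type*} (h : SameCuts C f f') (q : κ → ι) :
    SameCuts C (fun x => f (q x)) (fun x => f' (q x)) :=
  fun a b => h (q a) (q b)

theorem min {κ : Type*} (h : SameCuts C f f') (q r : κ → ι) :
    SameCuts C (fun x => Min.min (f (q x)) (f (r x))) (fun x => Min.min (f' (q x)) (f' (r x))) := by
  intro a b c hc d hd
  simp only [← min_add_add_right, le_min_iff, min_le_iff, h _ _ c hc d hd]

theorem eq_top_iff (h : SameCuts C f f') (hC : 1 ≤ C) (a : ι) : f a = ⊤ ↔ f' a = ⊤ := by
  have key : ∀ x : ℕ∞, x = ⊤ ↔ x + ((1 : ℕ) : ℕ∞) ≤ x + ((0 : ℕ) : ℕ∞) := by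
    intro x
    induction x using ENat.recTopCoe with
    | top => simp
    | coe n => norm_cast; simp
  rw [key, key, h a a 1 hC 0 (Nat.zero_le _)]

/-- A finite family of extended naturals can be extended by one more natural number `α`, at the cost
of roughly halving the offsets that are controlled. The index `b₀`, where both families vanish,
keeps `α'` from being forced below zero. -/
theorem exists_extend [Finite ι] (h : SameCuts (2 * C + 2) f f') (b₀ : ι) (hb : f b₀ = 0)
    (hb' : f' b₀ = 0) (α : ℕ) :
    ∃ α' : ℕ, SameCuts C (fun o : Option ι => o.elim (α : ℕ∞) f)
      (fun o : Option ι => o.elim (α' : ℕ∞) f') := by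
  suffices H : ∃ α' : ℕ, ∀ a, ∀ c ≤ C, ∀ d ≤ C,
      (f a + (c : ℕ∞) ≤ α + (d : ℕ∞) ↔ f' a + (c : ℕ∞) ≤ α' + (d : ℕ∞)) ∧
      (α + (c : ℕ∞) ≤ f a + (d : ℕ∞) ↔ α' + (c : ℕ∞) ≤ f' a + (d : ℕ∞)) by
    obtain ⟨α', H⟩ := H
    refine ⟨α', ?_⟩
    rintro (_ | a) (_ | b) c hc d hd
    · simp only [Option.elim]
      norm_cast
      omega
    · exact (H b c hc d hd).2
    · exact (H a c hc d hd).1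
    · exact h a b c (by omega) d (by omega)
  have hfin : ∀ a, (f a = ⊤ ∧ f' a = ⊤) ∨ ∃ n n' : ℕ, f a = n ∧ f' a = n' := by
    intro a
    have := h.eq_top_iff (by omega) a
    by_cases ha : f a = ⊤
    · exact Or.inl ⟨ha, this.1 ha⟩
    · obtain ⟨n, hn⟩ := ENat.ne_top_iff_exists.1 ha
      obtain ⟨n', hn'⟩ := ENat.ne_top_iff_exists.1 (fun h' => ha (this.2 h'))
      exact Or.inr ⟨n, n', hn.symm, hn'.symm⟩
  have hnat : ∀ a b, ∀ n n' k k' : ℕ, f a = n → f' a = n' → f b = k → f' b = k' →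
      ∀ c ≤ 2 * C + 2, ∀ d ≤ 2 * C + 2, (n + c ≤ k + d ↔ n' + c ≤ k' + d) := by
    intro a b n n' k k' h1 h2 h3 h4 c hc d hd
    have := h a b c hc d hd
    rw [h1, h2, h3, h4] at this
    exact_mod_cast this
  -- It suffices to compare `α` with the finite values of `f`.
  suffices H : ∃ α' : ℕ, ∀ a, ∀ n n' : ℕ, f a = n → f' a = n' → ∀ c ≤ C, ∀ d ≤ C,
      (n + c ≤ α + d ↔ n' + c ≤ α' + d) ∧ (α + c ≤ n + d ↔ α' + c ≤ n' + d) by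
    obtain ⟨α', H⟩ := H
    refine ⟨α', fun a c hc d hd => ?_⟩
    rcases hfin a with ⟨h1, h2⟩ | ⟨n, n', h1, h2⟩
    · rw [h1, h2]
      have e1 : ¬ ((⊤ : ℕ∞) ≤ ((α + d : ℕ) : ℕ∞)) := by simp
      have e2 : ¬ ((⊤ : ℕ∞) ≤ ((α' + d : ℕ) : ℕ∞)) := by simp
      push_cast at e1 e2
      simp [e1, e2]
    · have := H a n n' h1 h2 c hc d hd
      rw [h1, h2]
      exact_mod_cast this
  have hb0 : f b₀ = (0 : ℕ) := by simpa using hb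
  have hb0' : f' b₀ = (0 : ℕ) := by simpa using hb'
  by_cases hnear : ∃ a, ∃ τ τ' : ℕ, f a = τ ∧ f' a = τ' ∧ α ≤ τ + C ∧ τ ≤ α + C
  · obtain ⟨a, τ, τ', ha, ha', h1, h2⟩ := hnear
    -- Keep the exact distance to a nearby value.
    have hk := hnat b₀ a 0 0 τ τ' hb0 hb0' ha ha' (τ - α) (by omega) 0 (by omega)
    refine ⟨τ' + (α - τ) - (τ - α), fun b n n' hn hn' c hc d hd => ?_⟩
    have k1 := hnat b a n n' τ τ' hn hn' ha ha' (c + (τ - α)) (by omega) (d + (α - τ)) (by omega)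
    have k2 := hnat a b τ τ' n n' ha ha' hn hn' (c + (α - τ)) (by omega) (d + (τ - α)) (by omega)
    omega
  · push Not at hnear
    -- Go `C + 1` above the largest value below `α`.
    obtain ⟨a, ⟨τ, hτ, hlt⟩, hmax⟩ := Set.exists_max_image {a | ∃ n : ℕ, f a = n ∧ n < α} f
      (Set.toFinite _) ⟨b₀, 0, hb0, by have := hnear b₀ 0 0 hb0 hb0'; omega⟩
    obtain ⟨τ', hτ'⟩ : ∃ τ' : ℕ, f' a = τ' := by
      rcases hfin a with ⟨h1, _⟩ | ⟨_, n', _, h2⟩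
      · rw [h1] at hτ; exact absurd hτ (by simp)
      · exact ⟨n', h2⟩
    have n1 := hnear a τ τ' hτ hτ'
    refine ⟨τ' + C + 1, fun b n n' hn hn' c hc d hd => ?_⟩
    have n2 := hnear b n n' hn hn'
    have k1 := hnat b a n n' τ τ' hn hn' hτ hτ' 0 (by omega) 0 (by omega)
    have k2 := hnat a b τ τ' n n' hτ hτ' hn hn' (2 * C + 2) le_rfl 0 (by omega)
    by_cases hnα : n < α
    · have : n ≤ τ := by
        have := hmax b ⟨n, hn, hnα⟩
        rw [hn, hτ] at this
        exact_mod_cast this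
      omega
    · omega

end SameCuts

/-! ### Extending by one point: a single prime and finitely many primes -/

/-- A valuation smaller than `k` is unchanged by a perturbation divisible by `p ^ k`. -/
theorem emultiplicity_eq_of_pow_dvd_sub {R : Type*} [Ring R] {p x y : R} {k : ℕ}
    (h : p ^ k ∣ x - y) (hx : emultiplicity p x < k) : emultiplicity p y = emultiplicity p x := by
  have h1 : emultiplicity p (y - x) > emultiplicity p x := by
    rw [← neg_sub, emultiplicity_neg]
    exact hx.trans_le (le_emultiplicity_of_pow_dvd h)
  rw [show y = (y - x) + x by abel, emultiplicity_add_of_gt h1]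

/-- The valuation is locally constant away from `0`, uniformly on a finite family. -/
theorem exists_pow_dvd_sub_imp_emultiplicity_eq {ι : Type*} [Finite ι] {p : ℕ} (hp : p.Prime)
    (x : ι → ℤ) (hx : ∀ i, x i ≠ 0) :
    ∃ k : ℕ, ∀ i, ∀ y : ℤ, (p : ℤ) ^ k ∣ x i - y →
      emultiplicity (p : ℤ) y = emultiplicity (p : ℤ) (x i) := by
  have hfin : ∀ i, ∃ k : ℕ, emultiplicity (p : ℤ) (x i) = k := fun i => by
    have : FiniteMultiplicity (p : ℤ) (x i) :=
      Int.finiteMultiplicity_iff.2 ⟨by simpa using hp.ne_one, hx i⟩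
    exact ⟨_, this.emultiplicity_eq_multiplicity⟩
  choose k hk using hfin
  obtain ⟨B, hB⟩ := (Set.finite_range k).bddAbove
  refine ⟨B + 1, fun i y h => emultiplicity_eq_of_pow_dvd_sub h ?_⟩
  rw [hk]
  exact_mod_cast Nat.lt_succ_of_le (hB ⟨i, rfl⟩)

/-- Realization of a point in the `p`-adic tree. Let `u i₀` be nearest to `z` among the `u i`, at
valuation `α`. If the `u' i` lie in the same way with respect to balls of radius `α'` as the `u i`
do with respect to balls of radius `α`, there is an integer `z'` which branches off at valuation
`α'` from `u' i₀` and from every `u' i` in the ball around it. Such a `z'` needs a residue modulo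
`p` not occupied by the `u' i` of that ball; these occupy as many residues as the `u i` do, and
the latter leave at least the residue of `z` free. -/
theorem exists_emultiplicity_sub_eq_min {ι : Type*} {p : ℕ} (hp : p.Prime) (u u' : ι → ℤ)
    (i₀ : ι) (z : ℤ) {α α' : ℕ} (hmax : ∀ i, emultiplicity (p : ℤ) (z - u i) ≤ α)
    (hα : emultiplicity (p : ℤ) (z - u i₀) = α)
    (h0 : ∀ i j, (p : ℤ) ^ α ∣ u i - u j ↔ (p : ℤ) ^ α' ∣ u' i - u' j)
    (h1 : ∀ i j, (p : ℤ) ^ (α + 1) ∣ u i - u j ↔ (p : ℤ) ^ (α' + 1) ∣ u' i - u' j) :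
    ∃ z' : ℤ, ∀ i, emultiplicity (p : ℤ) (z' - u' i) =
      min (α' : ℕ∞) (emultiplicity (p : ℤ) (u' i - u' i₀)) := by
  have : Fact p.Prime := ⟨hp⟩
  have hp0 : ∀ k : ℕ, (p : ℤ) ^ k ≠ 0 := fun k => pow_ne_zero _ (by exact_mod_cast hp.ne_zero)
  let J := {i // (p : ℤ) ^ α ∣ u i - u i₀}
  choose m hm using fun i : J => i.2
  choose m' hm' using fun i : J => (h0 i.1 i₀).1 i.2
  obtain ⟨q, hq⟩ : (p : ℤ) ^ α ∣ z - u i₀ := pow_dvd_of_le_emultiplicity hα.ge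
  -- Two of the `u i` in the ball of radius `α` have the same residue iff the `u' i` do.
  have hres : ∀ i j : J, (m i : ZMod p) = m j ↔ (m' i : ZMod p) = m' j := by
    intro i j
    have key : ∀ (k : ℕ) (a b : ℤ),
        ((a : ZMod p) = b ↔ (p : ℤ) ^ (k + 1) ∣ p ^ k * a - p ^ k * b) := by
      intro k a b
      rw [← mul_sub, pow_succ, mul_dvd_mul_iff_left (hp0 k), ← ZMod.intCast_zmod_eq_zero_iff_dvd]
      rw [Int.cast_sub, sub_eq_zero]
    rw [key α, key α', ← hm, ← hm, ← hm', ← hm']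
    simpa using h1 i.1 j.1
  have hqm : ∀ i : J, (m i : ZMod p) ≠ q := by
    intro i hi
    rw [← sub_eq_zero, ← Int.cast_sub, ZMod.intCast_zmod_eq_zero_iff_dvd, dvd_sub_comm] at hi
    have : (p : ℤ) ^ (α + 1) ∣ z - u i := by
      rw [show z - u i = p ^ α * (q - m i) by rw [mul_sub, ← hq, ← hm]; ring, pow_succ]
      exact mul_dvd_mul_left _ hi
    have := (le_emultiplicity_of_pow_dvd this).trans (hmax i)
    norm_cast at this
    omega
  have hns : ¬ Function.Surjective (fun i : J => (m' i : ZMod p)) := by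
    intro hs
    obtain ⟨σ, hσ⟩ := hs.hasRightInverse
    have hinj : Function.Injective (fun r => (m (σ r) : ZMod p)) := by
      intro r s hrs
      have := (hres _ _).1 hrs
      exact (hσ r).symm.trans (this.trans (hσ s))
    obtain ⟨r, hr⟩ := Finite.surjective_of_injective hinj q
    exact hqm _ hr
  obtain ⟨r, hr⟩ := not_forall.1 hns
  obtain ⟨r, rfl⟩ := ZMod.intCast_surjective r
  refine ⟨u' i₀ + p ^ α' * r, fun i => ?_⟩
  -- Inside the ball, `r` avoids the residue of `u' i`; outside, the valuation is that of
  -- `u' i - u' i₀`.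
  by_cases hi : (p : ℤ) ^ α ∣ u i - u i₀
  · rw [min_eq_left (le_emultiplicity_of_pow_dvd ((h0 _ _).1 hi))]
    have e := hm' ⟨i, hi⟩
    simp only at e
    rw [show u' i₀ + p ^ α' * r - u' i = p ^ α' * (r - m' ⟨i, hi⟩) by linear_combination -e]
    refine emultiplicity_eq_of_dvd_of_not_dvd (dvd_mul_right _ _) ?_
    rw [pow_succ, mul_dvd_mul_iff_left (hp0 α'), dvd_sub_comm, ← ZMod.intCast_zmod_eq_zero_iff_dvd,
      Int.cast_sub, sub_eq_zero]
    exact fun h => hr ⟨_, h⟩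
  · have hlt : emultiplicity (p : ℤ) (u' i - u' i₀) < α' := by
      rw [emultiplicity_lt_iff_not_dvd]
      exact fun h => hi ((h0 _ _).2 h)
    rw [min_eq_right hlt.le, ← emultiplicity_neg (p : ℤ) (u' i - _)]
    rw [← emultiplicity_neg (p : ℤ)] at hlt
    refine emultiplicity_eq_of_pow_dvd_sub (k := α') ?_ hlt
    exact ⟨-r, by ring⟩

/-- If `y` is at least as near to `z` as `x` is, the distance from `z` to `x` is determined by the
distances from `y` to `z` and to `x`. -/
theorem emultiplicity_sub_eq_min {R : Type*} [Ring R] {p z x y : R}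
    (h : emultiplicity p (z - x) ≤ emultiplicity p (z - y)) :
    emultiplicity p (z - x) = min (emultiplicity p (z - y)) (emultiplicity p (x - y)) := by
  rcases h.lt_or_eq with h | h
  · rw [show x - y = (z - y) + -(z - x) by abel,
      emultiplicity_add_of_gt (by rwa [emultiplicity_neg]), emultiplicity_neg,
      min_eq_right h.le]
  · rw [h, eq_comm, min_eq_left_iff, show x - y = (z - y) + -(z - x) by abel]
    refine le_trans ?_ min_le_emultiplicity_add
    rw [emultiplicity_neg, h, min_self]

/-- The integers whose valuations are given in the extension problem: the mutual differences of the
centres `u` and the parameters `t`. -/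
def diffData {ι κ : Type*} (u : ι → ℤ) (t : κ → ℤ) : (ι × ι) ⊕ κ → ℤ :=
  Sum.elim (fun x => u x.1 - u x.2) t

/-- The integers whose valuations are of interest for a new point `z`: its differences with the
centres `u` and the parameters `t`. -/
def pointData {ι κ : Type*} (z : ℤ) (u : ι → ℤ) (t : κ → ℤ) : ι ⊕ κ → ℤ :=
  Sum.elim (fun i => z - u i) t

/-- The extension problem at one prime, for a point `z` different from all centres. If all
`z - u i` have valuation below `C`, the point `z` itself serves, since `u'` is congruent to `u`
modulo `p ^ C`. Otherwise the valuation of `z - u i₀`, where `u i₀` is a centre nearest to `z`, is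
transferred by `SameCuts.exists_extend`, and all other valuations are minima of it and data. The
parameter equal to `1`, of valuation `0`, makes comparisons with constants available. -/
theorem exists_pointData_sameCuts {ι κ : Type*} [Finite ι] [Finite κ] {p : ℕ} (hp : p.Prime)
    {C : ℕ} (hC : 1 ≤ C) (u u' : ι → ℤ) (t t' : κ → ℤ) (k₀ : κ) (hk : t k₀ = 1) (hk' : t' k₀ = 1)
    (hu : ∀ i, (p : ℤ) ^ C ∣ u i - u' i)
    (h : SameCuts (2 * C + 2) (fun x => emultiplicity (p : ℤ) (diffData u t x))
      (fun x => emultiplicity (p : ℤ) (diffData u' t' x)))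
    (z : ℤ) (hz : ∀ i, z ≠ u i) :
    ∃ z' : ℤ, (p : ℤ) ^ C ∣ z - z' ∧ (∀ i, z' ≠ u' i) ∧
      SameCuts C (fun x => emultiplicity (p : ℤ) (pointData z u t x))
        (fun x => emultiplicity (p : ℤ) (pointData z' u' t' x)) := by
  have hpu : ¬ IsUnit (p : ℤ) := (Nat.prime_iff_prime_int.1 hp).not_isUnit
  have h1 : emultiplicity (p : ℤ) (t k₀) = 0 := by rw [hk, emultiplicity_of_one_right hpu]
  have h1' : emultiplicity (p : ℤ) (t' k₀) = 0 := by rw [hk', emultiplicity_of_one_right hpu]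
  by_cases hsmall : ∀ i, emultiplicity (p : ℤ) (z - u i) < C
  · have heq : ∀ i, emultiplicity (p : ℤ) (z - u' i) = emultiplicity (p : ℤ) (z - u i) := fun i =>
      emultiplicity_eq_of_pow_dvd_sub (k := C)
        (by rw [show z - u i - (z - u' i) = -(u i - u' i) by ring]; exact (hu i).neg_right)
        (hsmall i)
    refine ⟨z, by simp, fun i hi => ?_, ?_⟩
    · have := hsmall i
      rw [← heq, hi, sub_self, emultiplicity_zero] at this
      exact absurd this (by simp)
    have hnat : ∀ i, ∃ n : ℕ, n < C ∧ emultiplicity (p : ℤ) (z - u i) = n := fun i => by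
      obtain ⟨n, hn⟩ := ENat.ne_top_iff_exists.1 (hsmall i).ne_top
      exact ⟨n, by have := hsmall i; rw [← hn] at this; exact_mod_cast this, hn.symm⟩
    rintro (i | k) (j | l) c hc d hd
    · simp only [pointData, Sum.elim_inl, heq]
    · obtain ⟨n, hn, hn'⟩ := hnat i
      have := h (Sum.inr k₀) (Sum.inr l) (n + c) (by omega) d (by omega)
      simpa [diffData, pointData, heq, hn', h1, h1'] using this
    · obtain ⟨n, hn, hn'⟩ := hnat j
      have := h (Sum.inr k) (Sum.inr k₀) c (by omega) (n + d) (by omega)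
      simpa [diffData, pointData, heq, hn', h1, h1'] using this
    · exact h (Sum.inr k) (Sum.inr l) c (by omega) d (by omega)
  · push Not at hsmall
    obtain ⟨i₁, hi₁⟩ := hsmall
    have : Nonempty ι := ⟨i₁⟩
    obtain ⟨i₀, hi₀⟩ := Finite.exists_max (fun i => emultiplicity (p : ℤ) (z - u i))
    obtain ⟨α, hα⟩ : ∃ α : ℕ, emultiplicity (p : ℤ) (z - u i₀) = α :=
      ⟨_, (Int.finiteMultiplicity_iff.2 ⟨by simpa using hp.ne_one,
        sub_ne_zero.2 (hz i₀)⟩).emultiplicity_eq_multiplicity⟩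
    have hCα : C ≤ α := by
      have := hi₁.trans (hi₀ i₁)
      rw [hα] at this
      exact_mod_cast this
    obtain ⟨α', hα'⟩ := h.exists_extend (Sum.inr k₀) h1 h1' α
    have hCα' : C ≤ α' := by
      have := hα' (some (Sum.inr k₀)) none C le_rfl 0 (Nat.zero_le _)
      simp only [Option.elim, diffData, Sum.elim_inr, h1, h1'] at this
      norm_cast at this
      omega
    obtain ⟨z', hz'⟩ := exists_emultiplicity_sub_eq_min hp u u' i₀ z (α := α) (α' := α')
      (fun i => hα ▸ hi₀ i) hα
      (fun i j => by
        rw [pow_dvd_iff_le_emultiplicity, pow_dvd_iff_le_emultiplicity]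
        simpa [diffData] using hα' none (some (Sum.inl (i, j))) 0 (by omega) 0 (by omega))
      (fun i j => by
        rw [pow_dvd_iff_le_emultiplicity, pow_dvd_iff_le_emultiplicity]
        simpa [diffData] using hα' none (some (Sum.inl (i, j))) 1 hC 0 (by omega))
    have hz : ∀ i, emultiplicity (p : ℤ) (z - u i) =
        min (α : ℕ∞) (emultiplicity (p : ℤ) (u i - u i₀)) := fun i => by
      rw [emultiplicity_sub_eq_min (hi₀ i), hα]
    refine ⟨z', ?_, fun i hi => ?_, ?_⟩
    · have e1 : (p : ℤ) ^ C ∣ z - u i₀ := by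
        rw [pow_dvd_iff_le_emultiplicity, hα]; exact_mod_cast hCα
      have e2 : (p : ℤ) ^ C ∣ z' - u' i₀ := by
        rw [pow_dvd_iff_le_emultiplicity, hz']; simpa using hCα'
      have := (e1.add (hu i₀)).sub e2
      rwa [show z - u i₀ + (u i₀ - u' i₀) - (z' - u' i₀) = z - z' by ring] at this
    · have := hz' i
      rw [hi, sub_self, emultiplicity_zero, eq_comm, min_eq_top] at this
      exact absurd this.1 (by simp)
    · have := hα'.min
        (Sum.elim (fun _ : ι => none) (fun k : κ => some (Sum.inr k)))
        (Sum.elim (fun i => some (Sum.inl (i, i₀))) (fun k => some (Sum.inr k)))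
      convert this using 1 <;> ext1 x <;> rcases x with i | k <;>
        simp [pointData, diffData, hz, hz']

/-- Solving `M * w ≡ x p` modulo `p ^ L p` simultaneously for finitely many primes. Since
`p ^ k ≤ M ≤ C` whenever `p ^ k ∣ M`, divisibility of `x p` by `p ^ C` makes each congruence
solvable. -/
theorem exists_int_mul_sub_dvd (F : Finset ℕ) (hF : ∀ p ∈ F, p.Prime) {M C : ℕ} (hM : 0 < M)
    (hMC : M ≤ C) (L : ℕ → ℕ) (x : ℕ → ℤ) (hx : ∀ p ∈ F, (p : ℤ) ^ C ∣ x p) :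
    ∃ w : ℤ, ∀ p ∈ F, (p : ℤ) ^ L p ∣ x p - M * w := by
  have hloc : ∀ p : F, ∃ w : ℤ, ((p : ℕ) : ℤ) ^ L p ∣ x p - M * w := by
    rintro ⟨p, hp⟩
    have hg : gcd (M : ℤ) ((p : ℤ) ^ L p) ∣ x p := by
      obtain ⟨k, hk, hk'⟩ := (Nat.dvd_prime_pow (hF p hp)).1 (Nat.gcd_dvd_right M (p ^ L p))
      have hkM : p ^ k ≤ M := Nat.le_of_dvd hM (hk' ▸ Nat.gcd_dvd_left _ _)
      have hkC : k ≤ C := (Nat.lt_pow_self (hF p hp).one_lt).le.trans (hkM.trans hMC)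
      have : gcd (M : ℤ) ((p : ℤ) ^ L p) = (p : ℤ) ^ k := by
        rw [← Nat.cast_pow, ← Int.coe_gcd, Int.gcd_natCast_natCast, hk']
        push_cast; rfl
      rw [this]
      exact (pow_dvd_pow _ hkC).trans (hx p hp)
    obtain ⟨w, v, hwv⟩ := (gcd_dvd_iff_exists _ _).1 hg
    exact ⟨w, v, by rw [hwv]; ring⟩
  choose w hw using hloc
  obtain ⟨r, hr⟩ := Ideal.exists_forall_sub_mem_ideal
    (I := fun p : F => Ideal.span {((p : ℕ) : ℤ) ^ L p}) (fun p q hpq => by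
      rw [Function.onFun, Ideal.isCoprime_span_singleton_iff]
      refine IsCoprime.pow ?_
      rw [Nat.isCoprime_iff_coprime, Nat.coprime_primes (hF p p.2) (hF q q.2)]
      exact fun h => hpq (Subtype.ext h)) w
  refine ⟨r, fun p hp => ?_⟩
  have h1 := hr ⟨p, hp⟩
  rw [Ideal.mem_span_singleton] at h1
  rw [show x p - M * r = x p - M * w ⟨p, hp⟩ - M * (r - w ⟨p, hp⟩) by ring]
  exact (hw ⟨p, hp⟩).sub (h1.mul_left (M : ℤ))

/-- The extension problem at finitely many primes, with a prescribed class of the new point modulo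
`M`. A point equal to the centre `u i` goes to `u' i`. Otherwise the solutions at the single primes
differ from all centres, so they may be perturbed, and the Chinese remainder theorem glues them. -/
theorem exists_pointData_sameCuts_of_finset {ι κ : Type*} [Finite ι] [Finite κ] (F : Finset ℕ)
    (hF : ∀ p ∈ F, p.Prime) {M C : ℕ} (hM : 0 < M) (hMC : M ≤ C) (u u' : ι → ℤ) (t t' : κ → ℤ)
    (k₀ : κ) (hk : t k₀ = 1) (hk' : t' k₀ = 1)
    (hu : ∀ i, ((M * ∏ p ∈ F, p ^ C : ℕ) : ℤ) ∣ u i - u' i)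
    (h : ∀ p ∈ F, SameCuts (2 * C + 2) (fun x => emultiplicity (p : ℤ) (diffData u t x))
      (fun x => emultiplicity (p : ℤ) (diffData u' t' x)))
    (z : ℤ) :
    ∃ z' : ℤ, (M : ℤ) ∣ z - z' ∧ ∀ p ∈ F,
      SameCuts C (fun x => emultiplicity (p : ℤ) (pointData z u t x))
        (fun x => emultiplicity (p : ℤ) (pointData z' u' t' x)) := by
  by_cases hz : ∃ i, z = u i
  · obtain ⟨i, rfl⟩ := hz
    refine ⟨u' i, (Int.natCast_dvd_natCast.2 (dvd_mul_right _ _)).trans (hu i), fun p hp => ?_⟩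
    have := ((h p hp).mono (B := C) (by omega)).comp
      (Sum.elim (fun j : ι => Sum.inl (i, j)) (fun k : κ => Sum.inr k))
    convert this using 1 <;> ext1 x <;> rcases x with j | k <;> rfl
  push Not at hz
  have hloc : ∀ p : ℕ, ∃ z' : ℤ, p ∈ F → (p : ℤ) ^ C ∣ z - z' ∧ (∀ i, z' ≠ u' i) ∧
      SameCuts C (fun x => emultiplicity (p : ℤ) (pointData z u t x))
        (fun x => emultiplicity (p : ℤ) (pointData z' u' t' x)) := by
    intro p
    by_cases hp : p ∈ F
    · obtain ⟨z', hz'⟩ := exists_pointData_sameCuts (hF p hp) (hM.trans_le hMC) u u' t t' k₀ hk hk'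
        (fun i => by
          refine dvd_trans ?_ (hu i)
          have : p ^ C ∣ M * ∏ p ∈ F, p ^ C :=
            (Finset.dvd_prod_of_mem (fun p => p ^ C) hp).mul_left M
          exact_mod_cast this)
        (h p hp) z hz
      exact ⟨z', fun _ => hz'⟩
    · exact ⟨0, fun h => absurd h hp⟩
  choose y hy using hloc
  have hL : ∀ p : ℕ, ∃ k : ℕ, p ∈ F → ∀ i, ∀ a : ℤ, (p : ℤ) ^ k ∣ (y p - u' i) - a →
      emultiplicity (p : ℤ) a = emultiplicity (p : ℤ) (y p - u' i) := by
    intro p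
    by_cases hp : p ∈ F
    · obtain ⟨k, hk⟩ := exists_pow_dvd_sub_imp_emultiplicity_eq (hF p hp) (fun i => y p - u' i)
        (fun i => sub_ne_zero.2 ((hy p hp).2.1 i))
      exact ⟨k, fun _ => hk⟩
    · exact ⟨0, fun h => absurd h hp⟩
  choose L hL using hL
  obtain ⟨w, hw⟩ := exists_int_mul_sub_dvd F hF hM hMC L (fun p => y p - z)
    (fun p hp => by rw [dvd_sub_comm]; exact (hy p hp).1)
  refine ⟨z + M * w, ⟨-w, by ring⟩, fun p hp => ?_⟩
  convert (hy p hp).2.2 using 1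
  ext1 x
  rcases x with i | k
  · refine hL p hp i _ ?_
    convert hw p hp using 1
    simp only [pointData, Sum.elim_inl]
    ring
  · rfl

/-! ### Terms of the language and indistinguishable tuples -/

namespace ValLang

open Language

variable {P : Set ℕ} {β : Type*}

theorem exists_term_add (t s : (valLang P).Term β) :
    ∃ r : (valLang P).Term β, ∀ w : β → ℤ, r.realize w = t.realize w + s.realize w :=
  ⟨Functions.apply₂ (L := valLang P) ValFunc.add t s, fun _ => Term.realize_functions_apply₂⟩

theorem exists_term_neg (t : (valLang P).Term β) :
    ∃ r : (valLang P).Term β, ∀ w : β → ℤ, r.realize w = -t.realize w :=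
  ⟨Functions.apply₁ (L := valLang P) ValFunc.neg t, fun _ => Term.realize_functions_apply₁⟩

theorem exists_term_sub (t s : (valLang P).Term β) :
    ∃ r : (valLang P).Term β, ∀ w : β → ℤ, r.realize w = t.realize w - s.realize w := by
  obtain ⟨s', hs'⟩ := exists_term_neg s
  obtain ⟨r, hr⟩ := exists_term_add t s'
  exact ⟨r, fun w => by rw [hr, hs', sub_eq_add_neg]⟩

theorem exists_term_zero : ∃ r : (valLang P).Term β, ∀ w : β → ℤ, r.realize w = 0 :=
  ⟨Constants.term (L := valLang P) ValFunc.zero, fun _ => Term.realize_constants⟩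

theorem exists_term_one : ∃ r : (valLang P).Term β, ∀ w : β → ℤ, r.realize w = 1 :=
  ⟨Constants.term (L := valLang P) ValFunc.one, fun _ => Term.realize_constants⟩

theorem exists_term_mul (c : ℤ) (t : (valLang P).Term β) :
    ∃ r : (valLang P).Term β, ∀ w : β → ℤ, r.realize w = c * t.realize w := by
  induction c using Int.induction_on with
  | zero => simpa using exists_term_zero
  | succ n ih =>
    obtain ⟨r, hr⟩ := ih
    obtain ⟨s, hs⟩ := exists_term_add r t
    exact ⟨s, fun w => by rw [hs, hr]; ring⟩
  | pred n ih =>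
    obtain ⟨r, hr⟩ := ih
    obtain ⟨s, hs⟩ := exists_term_sub r t
    exact ⟨s, fun w => by rw [hs, hr]; ring⟩

/-- Every term is of the form `a x + s` in its last variable `x`. -/
theorem exists_realize_snoc_eq {α : Type*} {m : ℕ} (t : (valLang P).Term (α ⊕ Fin (m + 1))) :
    ∃ (a : ℤ) (s : (valLang P).Term (α ⊕ Fin m)), ∀ (v : α → ℤ) (xs : Fin m → ℤ) (x : ℤ),
      t.realize (Sum.elim v (Fin.snoc xs x)) = a * x + s.realize (Sum.elim v xs) := by
  induction t with
  | var i =>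
    rcases i with i | i
    · exact ⟨0, Term.var (Sum.inl i), by simp⟩
    · induction i using Fin.lastCases with
      | last =>
        obtain ⟨s, hs⟩ := exists_term_zero (P := P) (β := α ⊕ Fin m)
        exact ⟨1, s, by simp [hs]⟩
      | cast i => exact ⟨0, Term.var (Sum.inr i), by simp⟩
  | func f ts ih =>
    choose a s h using ih
    cases f with
    | add =>
      obtain ⟨r, hr⟩ := exists_term_add (s 0) (s 1)
      refine ⟨a 0 + a 1, r, fun v xs x => ?_⟩
      rw [hr, Term.realize_func]
      change (ts 0).realize _ + (ts 1).realize _ = _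
      rw [h, h]
      ring
    | neg =>
      obtain ⟨r, hr⟩ := exists_term_neg (s 0)
      refine ⟨-a 0, r, fun v xs x => ?_⟩
      rw [hr, Term.realize_func]
      change -(ts 0).realize _ = _
      rw [h]
      ring
    | zero =>
      obtain ⟨r, hr⟩ := exists_term_zero (P := P) (β := α ⊕ Fin m)
      refine ⟨0, r, fun v xs x => ?_⟩
      rw [hr, Term.realize_func]
      change (0 : ℤ) = _
      ring
    | one =>
      obtain ⟨r, hr⟩ := exists_term_one (P := P) (β := α ⊕ Fin m)
      refine ⟨0, r, fun v xs x => ?_⟩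
      rw [hr, Term.realize_func]
      change (1 : ℤ) = _
      ring

/-- Two valuations of the variables are indistinguishable at the level `(F, N, 𝒯)` if the terms in
`𝒯` compare in the same way under `v_p` for every `p ∈ F` and have the same residues modulo `N`. -/
def Indist (F : Finset ℕ) (N : ℕ) (𝒯 : Set ((valLang P).Term β)) (w w' : β → ℤ) : Prop :=
  (∀ p ∈ F, ∀ t ∈ 𝒯, ∀ s ∈ 𝒯,
    (emultiplicity (p : ℤ) (t.realize w) ≤ emultiplicity (p : ℤ) (s.realize w) ↔
      emultiplicity (p : ℤ) (t.realize w') ≤ emultiplicity (p : ℤ) (s.realize w'))) ∧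
  ∀ t ∈ 𝒯, (N : ℤ) ∣ t.realize w - t.realize w'

namespace Indist

variable {F G : Finset ℕ} {M N : ℕ} {𝒮 𝒯 : Set ((valLang P).Term β)} {w w' : β → ℤ}

theorem mono (h : Indist F N 𝒯 w w') (hGF : G ⊆ F) (hMN : M ∣ N) (hST : 𝒮 ⊆ 𝒯) :
    Indist G M 𝒮 w w' :=
  ⟨fun p hp t ht s hs => h.1 p (hGF hp) t (hST ht) s (hST hs),
    fun t ht => (Int.natCast_dvd_natCast.2 hMN).trans (h.2 t (hST ht))⟩

theorem symm (h : Indist F N 𝒯 w w') : Indist F N 𝒯 w' w :=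
  ⟨fun p hp t ht s hs => (h.1 p hp t ht s hs).symm,
    fun t ht => by rw [dvd_sub_comm]; exact h.2 t ht⟩

end Indist

theorem exists_scaled_terms (F : Finset ℕ) (B : ℕ) {𝒯 : Set ((valLang P).Term β)}
    (h𝒯 : 𝒯.Finite) :
    ∃ 𝒮 : Set ((valLang P).Term β), 𝒮.Finite ∧ 𝒯 ⊆ 𝒮 ∧
      ∀ p ∈ F, ∀ c ≤ B, ∀ t ∈ 𝒯, ∃ s ∈ 𝒮, ∀ w : β → ℤ, s.realize w = (p : ℤ) ^ c * t.realize w := by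
  choose f hf using fun (x : ℕ × ℕ) (t : (valLang P).Term β) =>
    exists_term_mul ((x.1 : ℤ) ^ x.2) t
  refine ⟨𝒯 ∪ Set.image2 f (F ×ˢ Finset.range (B + 1) : Finset (ℕ × ℕ)) 𝒯,
    h𝒯.union ((Finset.finite_toSet _).image2 f h𝒯), Set.subset_union_left, ?_⟩
  intro p hp c hc t ht
  refine ⟨f (p, c) t, Or.inr ⟨(p, c), ?_, t, ht, rfl⟩, fun w => hf _ _ _⟩
  simp only [Finset.coe_product, Set.mem_prod, Finset.mem_coe, Finset.mem_range]
  exact ⟨hp, by omega⟩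

/-- Comparisons with offsets `c, d ≤ B` are plain comparisons between the multiples of the terms by
`p ^ c` and `p ^ d`. -/
theorem exists_finite_indist_imp_sameCuts (F : Finset ℕ) (hF : ∀ p ∈ F, p.Prime) (B : ℕ)
    {ι : Type*} [Finite ι] (τ : ι → (valLang P).Term β) :
    ∃ 𝒮 : Set ((valLang P).Term β), 𝒮.Finite ∧ ∀ (N : ℕ) (w w' : β → ℤ), Indist F N 𝒮 w w' →
      (∀ i, (N : ℤ) ∣ (τ i).realize w - (τ i).realize w') ∧
      ∀ p ∈ F, SameCuts B (fun i => emultiplicity (p : ℤ) ((τ i).realize w))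
        (fun i => emultiplicity (p : ℤ) ((τ i).realize w')) := by
  obtain ⟨𝒮, hfin, hsub, h𝒮⟩ := exists_scaled_terms F B (Set.finite_range τ)
  refine ⟨𝒮, hfin, fun N w w' h => ⟨fun i => h.2 _ (hsub ⟨i, rfl⟩), fun p hp i j c hc d hd => ?_⟩⟩
  obtain ⟨s, hs, hs'⟩ := h𝒮 p hp c hc _ ⟨i, rfl⟩
  obtain ⟨t, ht, ht'⟩ := h𝒮 p hp d hd _ ⟨j, rfl⟩
  have hp' := Nat.prime_iff_prime_int.1 (hF p hp)
  have := h.1 p hp s hs t ht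
  simpa only [hs', ht', emultiplicity_mul hp', emultiplicity_pow_self_of_prime hp',
    add_comm (_ : ℕ∞) (emultiplicity _ _)] using this

/-- The forth step: if two tuples are indistinguishable at a sufficiently fine level, then any
further entry `x` of the first is matched by an entry `x'` of the second. Writing each term as
`a x + s`, with `A` a common multiple of the nonzero coefficients `a` and `A = a b`, the product
`b (a x + s)` is the difference of the point `A x` and the centre `-b s`. -/
theorem exists_indist_snoc {α : Type*} {m : ℕ} (F : Finset ℕ) (hF : ∀ p ∈ F, p.Prime) {N : ℕ}
    (hN : 0 < N) {𝒯 : Set ((valLang P).Term (α ⊕ Fin (m + 1)))} (h𝒯 : 𝒯.Finite) :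
    ∃ (M : ℕ) (𝒮 : Set ((valLang P).Term (α ⊕ Fin m))), 0 < M ∧ 𝒮.Finite ∧
      ∀ (v v' : α → ℤ) (xs xs' : Fin m → ℤ),
        Indist F M 𝒮 (Sum.elim v xs) (Sum.elim v' xs') → ∀ x : ℤ, ∃ x' : ℤ,
          Indist F N 𝒯 (Sum.elim v (Fin.snoc xs x)) (Sum.elim v' (Fin.snoc xs' x')) := by
  have : Finite 𝒯 := h𝒯
  have := Fintype.ofFinite 𝒯
  choose a s hs using fun t : (valLang P).Term (α ⊕ Fin (m + 1)) => exists_realize_snoc_eq t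
  let ι := {t : 𝒯 // a t ≠ 0}
  let κ := Option {t : 𝒯 // a t = 0}
  -- `A` is a common multiple of the nonzero leading coefficients, with cofactors `b`.
  let A : ℤ := ∏ t : 𝒯, if a t = 0 then 1 else a t
  have hA : A ≠ 0 := Finset.prod_ne_zero_iff.2 fun t _ => by split_ifs <;> simp_all
  have hAdvd : ∀ t : ι, a t.1 ∣ A := fun t => by
    have := Finset.dvd_prod_of_mem (fun t : 𝒯 => if a t = 0 then 1 else a t) (Finset.mem_univ t.1)
    simpa [t.2] using this
  choose b hb using hAdvd
  have hb0 : ∀ t, b t ≠ 0 := fun t h => hA (by rw [hb t, h, mul_zero])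
  choose U hU using fun t : ι => exists_term_mul (-b t) (s t.1)
  choose D hD using fun (t : (valLang P).Term (α ⊕ Fin m)) t' => exists_term_sub t t'
  obtain ⟨I, hI⟩ := exists_term_one (P := P) (β := α ⊕ Fin m)
  let K : κ → (valLang P).Term (α ⊕ Fin m) := fun k => k.elim I (fun t => s t.1)
  -- The class of the new point modulo `C` decides divisibility by `A` and the class of the quotient
  -- modulo `N`. Moreover `C` bounds the valuations of the cofactors.
  let C : ℕ := N * A.natAbs
  have hC : 0 < C := Nat.mul_pos hN (Int.natAbs_pos.2 hA)
  have hbC : ∀ p ∈ F, ∀ t, ∃ e : ℕ, e ≤ C ∧ emultiplicity (p : ℤ) (b t) = e := by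
    intro p hp t
    have hfm := Int.finiteMultiplicity_iff (a := (p : ℤ)).2
      ⟨by simpa using (hF p hp).ne_one, hb0 t⟩
    refine ⟨_, ?_, hfm.emultiplicity_eq_multiplicity⟩
    have h1 : p ^ multiplicity (p : ℤ) (b t) ∣ C := by
      have h2 := pow_multiplicity_dvd (p : ℤ) (b t)
      have h3 : (b t).natAbs ∣ C :=
        (Int.natAbs_dvd_natAbs.2 ⟨a t.1, by rw [hb t, mul_comm]⟩ :
          (b t).natAbs ∣ A.natAbs).mul_left N
      refine dvd_trans ?_ h3
      have := Int.natAbs_dvd_natAbs.2 h2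
      rwa [Int.natAbs_pow, Int.natAbs_natCast] at this
    exact (Nat.lt_pow_self (hF p hp).one_lt).le.trans (Nat.le_of_dvd hC h1)
  obtain ⟨𝒮, h𝒮, hind⟩ := exists_finite_indist_imp_sameCuts F hF (2 * C + 2)
    (Sum.elim (fun t : 𝒯 => s t)
      (Sum.elim U (Sum.elim (fun x : ι × ι => D (U x.1) (U x.2)) K)))
  refine ⟨C * ∏ p ∈ F, p ^ C, 𝒮,
    Nat.mul_pos hC (Finset.prod_pos fun p hp => pow_pos (hF p hp).pos _), h𝒮, ?_⟩
  intro v v' xs xs' h x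
  obtain ⟨hcong, hcuts⟩ := hind _ _ _ h
  set w := Sum.elim v xs
  set w' := Sum.elim v' xs'
  obtain ⟨z', hz', hz'cuts⟩ := exists_pointData_sameCuts_of_finset F hF hC le_rfl
    (fun t => (U t).realize w) (fun t => (U t).realize w') (fun k => (K k).realize w)
    (fun k => (K k).realize w') none (hI w) (hI w') (fun t => hcong (Sum.inr (Sum.inl t)))
    (fun p hp => by
      convert (hcuts p hp).comp (Sum.inr ∘ Sum.inr) using 1 <;> ext1 y <;> rcases y with y | y <;>
        simp [diffData, hD])
    (A * x)
  have hCA : ((C : ℕ) : ℤ) = N * |A| := by simp [C]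
  obtain ⟨x', rfl⟩ : A ∣ z' := by
    have h1 : A ∣ A * x - z' :=
      dvd_trans (by rw [hCA]; exact ((dvd_abs A A).2 dvd_rfl).mul_left _) hz'
    simpa using (dvd_mul_right A x).sub h1
  have hx : (N : ℤ) ∣ x - x' := by
    rw [hCA, ← mul_sub] at hz'
    have h1 : A * (N : ℤ) ∣ A * (x - x') := by
      refine dvd_trans ?_ hz'
      rw [mul_comm]
      exact mul_dvd_mul_left _ ((dvd_abs A A).2 dvd_rfl)
    exact (mul_dvd_mul_iff_left hA).1 h1
  refine ⟨x', ?_, ?_⟩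
  · -- Scaling a form `a x + s` by its cofactor gives `A x - U`.
    have hval : ∀ p ∈ F, ∀ t : 𝒯, ∃ e : ℕ, e ≤ C ∧ ∃ y : ι ⊕ κ,
        emultiplicity (p : ℤ) (pointData (A * x) (fun t => (U t).realize w)
          (fun k => (K k).realize w) y) = e + emultiplicity (p : ℤ)
            (Term.realize (Sum.elim v (Fin.snoc xs x)) t.1) ∧
        emultiplicity (p : ℤ) (pointData (A * x') (fun t => (U t).realize w')
          (fun k => (K k).realize w') y) = e + emultiplicity (p : ℤ)
            (Term.realize (Sum.elim v' (Fin.snoc xs' x')) t.1) := by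
      intro p hp t
      by_cases ht : a t = 0
      · refine ⟨0, Nat.zero_le _, Sum.inr (some ⟨t, ht⟩), ?_, ?_⟩ <;>
          simp [pointData, K, hs, ht, w, w']
      · obtain ⟨e, he, hbe⟩ := hbC p hp ⟨t, ht⟩
        have hp' := Nat.prime_iff_prime_int.1 (hF p hp)
        refine ⟨e, he, Sum.inl ⟨t, ht⟩, ?_, ?_⟩ <;>
        · rw [← hbe, ← emultiplicity_mul hp', hs]
          simp only [pointData, Sum.elim_inl, hU]
          congr 1
          have := hb ⟨t, ht⟩
          simp only at this
          conv_lhs => rw [this]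
          ring
    intro p hp t ht t' ht'
    obtain ⟨e, he, y, h1, h2⟩ := hval p hp ⟨t, ht⟩
    obtain ⟨e', he', y', h1', h2'⟩ := hval p hp ⟨t', ht'⟩
    have := hz'cuts p hp y y' e' he' e he
    simp only [h1, h2, h1', h2'] at this
    have key : ∀ r r' : ℕ∞, (e : ℕ∞) + r + e' ≤ e' + r' + e ↔ r ≤ r' := by
      intro r r'
      rw [show (e : ℕ∞) + r + e' = ((e + e' : ℕ) : ℕ∞) + r by push_cast; ring,
        show (e' : ℕ∞) + r' + e = ((e + e' : ℕ) : ℕ∞) + r' by push_cast; ring]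
      exact ENat.add_le_add_iff_left (ENat.natCast_ne_top _)
    rwa [key, key] at this
  · intro t ht
    have hNM : (N : ℤ) ∣ ((C * ∏ p ∈ F, p ^ C : ℕ) : ℤ) :=
      Int.natCast_dvd_natCast.2 ((dvd_mul_right N _).mul_right _)
    have hst : (N : ℤ) ∣ (s t).realize w - (s t).realize w' := hNM.trans (hcong (Sum.inl ⟨t, ht⟩))
    rw [hs, hs, add_sub_add_comm, ← mul_sub]
    exact (hx.mul_left (a t)).add hst

/-! ### Invariance of formulas and quantifier-free definability -/

variable {α : Type*} {m : ℕ}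

/-- A formula is invariant if its truth in the integers is preserved between tuples that are
indistinguishable at some finite level. -/
def IsIndistInvariant (φ : (valLang P).BoundedFormula α m) : Prop :=
  ∃ (F : Finset ℕ) (N : ℕ) (𝒯 : Set ((valLang P).Term (α ⊕ Fin m))),
    (∀ p ∈ F, p ∈ P) ∧ 0 < N ∧ 𝒯.Finite ∧ ∀ (v v' : α → ℤ) (xs xs' : Fin m → ℤ),
      Indist F N 𝒯 (Sum.elim v xs) (Sum.elim v' xs') → (φ.Realize v xs ↔ φ.Realize v' xs')

theorem emultiplicity_le_iff_eq_zero {p : ℕ} (hp : p.Prime) (x : ℤ) :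
    emultiplicity (p : ℤ) 0 ≤ emultiplicity (p : ℤ) x ↔ x = 0 := by
  rw [emultiplicity_zero, top_le_iff, emultiplicity_eq_top, Int.finiteMultiplicity_iff]
  simp [hp.ne_one]

/-- An equation `t₁ = t₂` says that `0 |_p t₁ - t₂`, for any `p ∈ P`; such a `p` exists because `P`
is nonempty. -/
theorem isIndistInvariant_equal (hne : P.Nonempty) (hP : ∀ p ∈ P, p.Prime)
    (t₁ t₂ : (valLang P).Term (α ⊕ Fin m)) :
    IsIndistInvariant (BoundedFormula.equal t₁ t₂) := by
  obtain ⟨p, hp⟩ := hne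
  obtain ⟨r, hr⟩ := exists_term_sub t₁ t₂
  obtain ⟨o, ho⟩ := exists_term_zero (P := P) (β := α ⊕ Fin m)
  refine ⟨{p}, 1, {o, r}, by simpa using hp, one_pos, by simp, fun v v' xs xs' h => ?_⟩
  have := h.1 p (by simp) o (by simp) r (by simp)
  simp only [ho, hr, emultiplicity_le_iff_eq_zero (hP p hp), sub_eq_zero] at this
  exact this

theorem isIndistInvariant_rel {l : ℕ} (R : (valLang P).Relations l)
    (ts : Fin l → (valLang P).Term (α ⊕ Fin m)) :
    IsIndistInvariant (BoundedFormula.rel R ts) := by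
  cases R with
  | dvd p =>
    refine ⟨{(p : ℕ)}, 1, {ts 0, ts 1}, by simp, one_pos, by simp, fun v v' xs xs' h => ?_⟩
    exact h.1 p (by simp) _ (by simp) _ (by simp)
  | D n =>
    refine ⟨∅, n, {ts 0}, by simp, n.pos, by simp, fun v v' xs xs' h => ?_⟩
    exact (dvd_iff_dvd_of_dvd_sub (h.2 (ts 0) (by simp)))

theorem isIndistInvariant (hne : P.Nonempty) (hP : ∀ p ∈ P, p.Prime)
    (φ : (valLang P).BoundedFormula α m) : IsIndistInvariant φ := by
  induction φ with
  | falsum => exact ⟨∅, 1, ∅, by simp, one_pos, Set.finite_empty, fun _ _ _ _ _ => Iff.rfl⟩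
  | equal t₁ t₂ => exact isIndistInvariant_equal hne hP t₁ t₂
  | rel R ts => exact isIndistInvariant_rel R ts
  | imp φ ψ ihφ ihψ =>
    obtain ⟨F, M, 𝒮, hF, hM, h𝒮, hφ⟩ := ihφ
    obtain ⟨G, N, 𝒯, hG, hN, h𝒯, hψ⟩ := ihψ
    refine ⟨F ∪ G, M * N, 𝒮 ∪ 𝒯, fun p hp => (Finset.mem_union.1 hp).elim (hF p) (hG p),
      Nat.mul_pos hM hN, h𝒮.union h𝒯, fun v v' xs xs' h => ?_⟩
    exact imp_congr
      (hφ _ _ _ _ (h.mono Finset.subset_union_left (dvd_mul_right _ _) Set.subset_union_left))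
      (hψ _ _ _ _ (h.mono Finset.subset_union_right (dvd_mul_left _ _) Set.subset_union_right))
  | all φ ih =>
    obtain ⟨F, N, 𝒯, hF, hN, h𝒯, hφ⟩ := ih
    obtain ⟨M, 𝒮, hM, h𝒮, hext⟩ := exists_indist_snoc F (fun p hp => hP p (hF p hp)) hN h𝒯
    have key : ∀ (v v' : α → ℤ) (xs xs' : _ → ℤ),
        Indist F M 𝒮 (Sum.elim v xs) (Sum.elim v' xs') → φ.all.Realize v' xs' →
          φ.all.Realize v xs := by
      intro v v' xs xs' h hall x
      obtain ⟨x', hx'⟩ := hext v v' xs xs' h x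
      exact (hφ _ _ _ _ hx').2 (hall x')
    exact ⟨F, M, 𝒮, hF, hM, h𝒮, fun v v' xs xs' h =>
      ⟨key v' v xs' xs h.symm, key v v' xs xs' h⟩⟩

/-- A relation that depends only on the truth values of finitely many quantifier-free formulas is
defined by a Boolean combination of them. -/
theorem exists_isQF_of_saturated {L : Language} {M : Type*} [L.Structure M]
    {Γ : Set (L.BoundedFormula α m)} (hΓ : Γ.Finite) (hqf : ∀ γ ∈ Γ, γ.IsQF)
    (S : (α → M) → (Fin m → M) → Prop)
    (hS : ∀ v xs v' xs', (∀ γ ∈ Γ, γ.Realize v xs ↔ γ.Realize v' xs') → S v xs → S v' xs') :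
    ∃ ψ : L.BoundedFormula α m, ψ.IsQF ∧ ∀ v xs, ψ.Realize v xs ↔ S v xs := by
  induction Γ, hΓ using Set.Finite.induction_on generalizing S with
  | empty =>
    by_cases h : ∃ v xs, S v xs
    · obtain ⟨v, xs, h⟩ := h
      exact ⟨⊤, BoundedFormula.IsQF.top, fun v' xs' => by
        simpa using hS v xs v' xs' (by simp) h⟩
    · push Not at h
      exact ⟨⊥, BoundedFormula.isQF_bot, fun v xs => by simpa using h v xs⟩
  | @insert γ Γ _ _ ih =>
    have hqf' : ∀ δ ∈ Γ, δ.IsQF := fun δ hδ => hqf δ (Set.mem_insert_of_mem _ hδ)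
    -- The `Γ`-saturations of the parts of `S` on which `γ` is true, respectively false.
    obtain ⟨ψ₁, h₁, hψ₁⟩ := ih hqf' (fun v xs => ∃ v' xs', S v' xs' ∧ γ.Realize v' xs' ∧
        ∀ δ ∈ Γ, δ.Realize v' xs' ↔ δ.Realize v xs) (by
      rintro v xs v' xs' h ⟨u, us, h1, h2, h3⟩
      exact ⟨u, us, h1, h2, fun δ hδ => (h3 δ hδ).trans (h δ hδ)⟩)
    obtain ⟨ψ₂, h₂, hψ₂⟩ := ih hqf' (fun v xs => ∃ v' xs', S v' xs' ∧ ¬ γ.Realize v' xs' ∧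
        ∀ δ ∈ Γ, δ.Realize v' xs' ↔ δ.Realize v xs) (by
      rintro v xs v' xs' h ⟨u, us, h1, h2, h3⟩
      exact ⟨u, us, h1, h2, fun δ hδ => (h3 δ hδ).trans (h δ hδ)⟩)
    have hγ := hqf γ (Set.mem_insert _ _)
    refine ⟨(γ ⊓ ψ₁) ⊔ (γ.not ⊓ ψ₂), (hγ.inf h₁).sup (hγ.not.inf h₂), fun v xs => ?_⟩
    simp only [BoundedFormula.realize_sup, BoundedFormula.realize_inf, BoundedFormula.realize_not,
      hψ₁, hψ₂]
    constructor
    · rintro (⟨hg, v', xs', h1, h2, h3⟩ | ⟨hg, v', xs', h1, h2, h3⟩) <;>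
      · refine hS v' xs' v xs ?_ h1
        rintro δ (rfl | hδ)
        · simp [hg, h2]
        · exact h3 δ hδ
    · intro h
      by_cases hg : γ.Realize v xs
      · exact Or.inl ⟨hg, v, xs, h, hg, fun _ _ => Iff.rfl⟩
      · exact Or.inr ⟨hg, v, xs, h, hg, fun _ _ => Iff.rfl⟩

/-- Indistinguishability at a finite level is implied by agreement on finitely many quantifier-free
formulas: `t |_p s`, and `D_N (t - r)` for `r < N`. -/
theorem exists_finite_isQF_imp_indist {F : Finset ℕ} (hF : ∀ p ∈ F, p ∈ P) {N : ℕ} (hN : 0 < N)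
    {𝒯 : Set ((valLang P).Term (α ⊕ Fin m))} (h𝒯 : 𝒯.Finite) :
    ∃ Γ : Set ((valLang P).BoundedFormula α m), Γ.Finite ∧ (∀ γ ∈ Γ, γ.IsQF) ∧
      ∀ (v : α → ℤ) (xs : Fin m → ℤ) (v' : α → ℤ) (xs' : Fin m → ℤ),
        (∀ γ ∈ Γ, γ.Realize v xs ↔ γ.Realize v' xs') →
          Indist F N 𝒯 (Sum.elim v xs) (Sum.elim v' xs') := by
  obtain ⟨I, hI⟩ := exists_term_one (P := P) (β := α ⊕ Fin m)
  choose c hc using fun r : ℕ => exists_term_mul (r : ℤ) I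
  choose D hD using fun (t : (valLang P).Term (α ⊕ Fin m)) t' => exists_term_sub t t'
  have := h𝒯.to_subtype
  let f : F × 𝒯 × 𝒯 → (valLang P).BoundedFormula α m := fun x =>
    Relations.boundedFormula₂ (L := valLang P) (ValRel.dvd ⟨x.1, hF _ x.1.2⟩) x.2.1 x.2.2
  let g : 𝒯 × Fin N → (valLang P).BoundedFormula α m := fun x =>
    Relations.boundedFormula₁ (L := valLang P) (ValRel.D ⟨N, hN⟩) (D x.1 (c x.2))
  have hf : ∀ x v xs, (f x).Realize v xs ↔
      emultiplicity ((x.1 : ℕ) : ℤ) (Term.realize (Sum.elim v xs) x.2.1.1) ≤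
        emultiplicity ((x.1 : ℕ) : ℤ) (Term.realize (Sum.elim v xs) x.2.2.1) := fun x v xs =>
    BoundedFormula.realize_rel₂
  have hg : ∀ x v xs, (g x).Realize v xs ↔
      (N : ℤ) ∣ Term.realize (Sum.elim v xs) x.1.1 - (x.2 : ℕ) := fun x v xs => by
    have := BoundedFormula.realize_rel₁ (L := valLang P) (R := ValRel.D ⟨N, hN⟩)
      (t := D x.1 (c x.2)) (v := v) (xs := xs)
    refine this.trans ?_
    change (N : ℤ) ∣ (D x.1 (c x.2)).realize (Sum.elim v xs) ↔ _
    rw [hD, hc, hI, mul_one]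
  refine ⟨Set.range f ∪ Set.range g, (Set.finite_range f).union (Set.finite_range g), ?_, ?_⟩
  · rintro _ (⟨x, rfl⟩ | ⟨x, rfl⟩) <;> exact (BoundedFormula.IsAtomic.rel _ _).isQF
  · intro v xs v' xs' h
    refine ⟨fun p hp t ht s hs => ?_, fun t ht => ?_⟩
    · rw [← hf (⟨p, hp⟩, ⟨t, ht⟩, ⟨s, hs⟩), ← hf (⟨p, hp⟩, ⟨t, ht⟩, ⟨s, hs⟩)]
      exact h _ (Or.inl ⟨_, rfl⟩)
    · have hN' : (N : ℤ) ≠ 0 := by exact_mod_cast hN.ne'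
      obtain ⟨r, hr⟩ := Int.eq_ofNat_of_zero_le
        (Int.emod_nonneg (t.realize (Sum.elim v xs)) hN')
      have hrN : r < N := by
        have := Int.emod_lt_of_pos (t.realize (Sum.elim v xs)) (by exact_mod_cast hN : (0 : ℤ) < N)
        rw [hr] at this
        exact_mod_cast this
      have h1 : (N : ℤ) ∣ t.realize (Sum.elim v xs) - r := hr ▸ Int.dvd_self_sub_emod
      have h2 := (h _ (Or.inr ⟨(⟨t, ht⟩, ⟨r, hrN⟩), rfl⟩)).1 ((hg _ _ _).2 h1)
      rw [hg] at h2
      simpa using h1.sub h2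

theorem exists_isQF_realize_iff (hne : P.Nonempty) (hP : ∀ p ∈ P, p.Prime)
    (φ : (valLang P).BoundedFormula α m) :
    ∃ ψ : (valLang P).BoundedFormula α m, ψ.IsQF ∧
      ∀ (v : α → ℤ) (xs : Fin m → ℤ), ψ.Realize v xs ↔ φ.Realize v xs := by
  obtain ⟨F, N, 𝒯, hF, hN, h𝒯, hφ⟩ := isIndistInvariant hne hP φ
  obtain ⟨Γ, hΓ, hqf, hind⟩ := exists_finite_isQF_imp_indist hF hN h𝒯
  exact exists_isQF_of_saturated hΓ hqf (fun v xs => φ.Realize v xs)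
    fun v xs v' xs' h => (hφ _ _ _ _ (hind v xs v' xs' h)).1

/-- The universal closure of `φ ↔ ψ`. -/
noncomputable def iffSentence {L : Language} {n : ℕ} (φ ψ : L.Formula (Fin n)) : L.Sentence :=
  ((φ.iff ψ).relabel (Sum.inr : Fin n → Empty ⊕ Fin n)).iAlls (Fin n)

theorem realize_iffSentence {L : Language} {n : ℕ} (φ ψ : L.Formula (Fin n)) (K : Type*)
    [L.Structure K] :
    K ⊨ iffSentence φ ψ ↔ ∀ v : Fin n → K, φ.Realize v ↔ ψ.Realize v := by
  simp only [iffSentence, Sentence.Realize, Formula.realize_iAlls, Formula.realize_relabel,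
    Formula.realize_iff]
  rfl

theorem completeTheory_iff_of_realize_iff {L : Language} {M : Type*} [L.Structure M]
    {n : ℕ} {φ ψ : L.Formula (Fin n)} (h : ∀ v : Fin n → M, φ.Realize v ↔ ψ.Realize v) :
    φ ⇔[L.completeTheory M] ψ := by
  intro K v xs
  have hK : K ⊨ iffSentence φ ψ := Theory.realize_sentence_of_mem (L.completeTheory M)
    (Language.mem_completeTheory.2 ((realize_iffSentence φ ψ M).2 h))
  rw [BoundedFormula.realize_iff, Subsingleton.elim xs default]
  exact (realize_iffSentence φ ψ K).1 hK v

end ValLang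

theorem theorem1p1 (P : Set ℕ) (hne : P.Nonempty) (hP : ∀ p ∈ P, Nat.Prime p) :
    EliminatesQuantifiers (valTheory P) := by
  intro n φ
  obtain ⟨ψ, hψ, h⟩ := ValLang.exists_isQF_realize_iff hne hP φ
  exact ⟨ψ, hψ, ValLang.completeTheory_iff_of_realize_iff fun v => (h v _).symm⟩
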